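/- For $n\ge 0$ let $C_n(\mathbb C)=\{(z_1,\dots,z_n)\in\mathbb C^n : z_i\ne z_j \text{ for } i\ne j\}$ with the subspace topology, and for $p\in C_n(\mathbb C)$ let $PB_n=\pi_1(C_n(\mathbb C),p)$ be the pure braid group. Let $f:C_{n+1}(\mathbb C)\to C_n(\mathbb C)$, $(z_1,\dots,z_{n+1})\mapsto(z_1,\dots,z_n)$, be the forgetful map and let $s:C_n(\mathbb C)\to C_{n+1}(\mathbb C)$, $(z_1,\dots,z_n)\mapsto(z_1,\dots,z_n,|z_1|+\dots+|z_n|+1)$, be its cross-section. Let $F_k$ denote the free group on $k$ generators. **Theorem.** Let $n\ge 1$. 1. For all base points $p\in C_n(\mathbb C)$ and $q\in C_{n+1}(\mathbb C)$ there are an action of $\pi_1(C_n(\mathbb C),p)$ on $F_n$ by automorphisms and an isomorphism of groups $$PB_{n+1}=\pi_1(C_{n+1}(\mathbb C),q)\;\cong\;F_n\rtimes \pi_1(C_n(\mathbb C),p)=F_n\rtimes PB_n .$$ 2. For every $q\in C_{n+1}(\mathbb C)$ and $p=f(q)$, the action and the isomorphism can be chosen so that $f_*:\pi_1(C_{n+1}(\mathbb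 C),q)\to\pi_1(C_n(\mathbb C),f(q))$ corresponds to the projection $F_n\rtimes PB_n\to PB_n$ and, if moreover $s(f(q))=q$, so that $s_*:\pi_1(C_n(\mathbb C),f(q))\to\pi_1(C_{n+1}(\mathbb C),q)$ corresponds to the inclusion $PB_n\to F_n\rtimes PB_n$. 3. For every base point, $PB_{n+1}$ is isomorphic to an iterated semidirect product of free groups $$PB_{n+1}\;\cong\;F_n\rtimes\bigl(F_{n-1}\rtimes(\cdots\rtimes(F_3\rtimes(F_2\rtimes F_1)))\bigr)$$ for suitable actions (for $n=1$ the right-hand side is $F_1$). -/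

import Mathlib

/-- The configuration space `C_n(ℂ)` of ordered `n`-tuples of pairwise distinct points of `ℂ`,
with the subspace topology inherited from `ℂⁿ`. -/
abbrev ConfSpace (n : ℕ) : Type :=
  {z : Fin n → ℂ // ∀ i j : Fin n, i ≠ j → z i ≠ z j}

/-- The pure braid group `PB_n = π₁(C_n(ℂ), p)` with base point `p`. -/
abbrev PureBraidGroup (n : ℕ) (p : ConfSpace n) : Type :=
  FundamentalGroup (ConfSpace n) p

/-- The forgetful map `C_{n+1}(ℂ) → C_n(ℂ)`, `(z₁, …, z_{n+1}) ↦ (z₁, …, z_n)`. -/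
def forgetLast (n : ℕ) : C(ConfSpace (n + 1), ConfSpace n) where
  toFun z := ⟨fun i => z.1 i.castSucc, fun i j hij =>
    z.2 i.castSucc j.castSucc fun h => hij (Fin.castSucc_injective n h)⟩
  continuous_toFun := Continuous.subtype_mk (continuous_pi fun i =>
    (continuous_apply i.castSucc).comp continuous_subtype_val) _

theorem ne_sum_norm_add_one {n : ℕ} (z : Fin n → ℂ) (i : Fin n) :
    z i ≠ (((∑ j, ‖z j‖) + 1 : ℝ) : ℂ) := by
  intro h
  have h0 : (0 : ℝ) ≤ ∑ j, ‖z j‖ := Finset.sum_nonneg fun j _ => norm_nonneg _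
  have h1 : ‖z i‖ ≤ ∑ j, ‖z j‖ :=
    Finset.single_le_sum (f := fun j => ‖z j‖) (fun j _ => norm_nonneg _) (Finset.mem_univ i)
  have h2 : ‖z i‖ = (∑ j, ‖z j‖) + 1 := by
    conv_lhs => rw [h]
    rw [Complex.norm_real, Real.norm_of_nonneg (by linarith)]
  linarith

/-- The cross-section `C_n(ℂ) → C_{n+1}(ℂ)` of the forgetful map,
`(z₁, …, z_n) ↦ (z₁, …, z_n, |z₁| + … + |z_n| + 1)`. -/
noncomputable def addPoint (n : ℕ) : C(ConfSpace n, ConfSpace (n + 1)) where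
  toFun z := ⟨Fin.snoc (α := fun _ => ℂ) z.1 (((∑ j, ‖z.1 j‖) + 1 : ℝ) : ℂ), by
    intro i j
    refine Fin.lastCases ?_ (fun i => ?_) i <;> refine Fin.lastCases ?_ (fun j => ?_) j
    · intro h
      exact absurd rfl h
    · intro _
      rw [Fin.snoc_last, Fin.snoc_castSucc]
      exact (ne_sum_norm_add_one z.1 j).symm
    · intro _
      rw [Fin.snoc_last, Fin.snoc_castSucc]
      exact ne_sum_norm_add_one z.1 i
    · intro h
      rw [Fin.snoc_castSucc, Fin.snoc_castSucc]
      exact z.2 i j fun hij => h (congrArg Fin.castSucc hij)⟩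
  continuous_toFun := by
    have hc : ∀ k : Fin n, Continuous fun z : ConfSpace n => z.1 k := fun k =>
      (continuous_apply k).comp continuous_subtype_val
    refine Continuous.subtype_mk (continuous_pi fun i => ?_) _
    refine Fin.lastCases ?_ (fun i => ?_) i
    · simp only [Fin.snoc_last]
      exact Complex.continuous_ofReal.comp
        ((continuous_finsetSum _ fun k _ => (hc k).norm).add continuous_const)
    · simp only [Fin.snoc_castSucc]
      exact hc i

/-- `IsIteratedSemidirectFree n G` says that `G` is one of the iterated semidirect products
`F_n ⋊ (F_{n-1} ⋊ (⋯ ⋊ (F_2 ⋊ F_1)))`, for some choice of the actions; here `F_k` is the free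
group on `k` generators and `n ≥ 1`. -/
inductive IsIteratedSemidirectFree : ∀ (_ : ℕ) (G : Type) [Group G], Prop
  | base : IsIteratedSemidirectFree 1 (FreeGroup (Fin 1))
  | step (n : ℕ) (H : Type) [Group H] (φ : H →* MulAut (FreeGroup (Fin (n + 1)))) :
      IsIteratedSemidirectFree n H →
        IsIteratedSemidirectFree (n + 1) (FreeGroup (Fin (n + 1)) ⋊[φ] H)

/-!
The forgetful map `forgetLast n : C_{n+1}(ℂ) → C_n(ℂ)` behaves like a fibration with section
`addPoint n`, and its fibre over `p` is the plane with the `n` points of `p` removed. A group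
homomorphism with a section presents its source as the semidirect product of its kernel with its
target (`exists_semidirectProduct_of_section`), so everything rests on showing that the kernel of
`π₁(C_{n+1}(ℂ)) → π₁(C_n(ℂ))` is free of rank `n` (`nonempty_freeGroup_mulEquiv_ker`).

*The kernel is the fundamental group of the fibre.* Instead of local triviality, the argument uses
parallel transport over compact parameter spaces (`ConfSpace.exists_transport`): for nearby
configurations `z` and `w` the map `push δ z w` moves `z i` to `w i` and every other point of the
plane to a point outside `w`, and a path of configurations is followed by composing such maps along
a fine subdivision. Transporting along a null-homotopy deforms every loop in the kernel into the
fibre (`exists_map_fiberInclusion_eq`). Injectivity of `π₁(fibre) → π₁(C_{n+1}(ℂ))` uses the section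
in place of the vanishing of a boundary map: a null-homotopy `K` and the composite
`addPoint ∘ forgetLast ∘ K` have the same projection, so that transporting both back to the fibre
compares a loop of the fibre with the constant loop (`map_fiberInclusion_injective`).

*The fundamental group of the fibre is free.* By connectedness only one fibre is needed, and the
configuration `(0, …, n - 1)` is convenient: the punctured plane is the union of two simply
connected open sets, the complements of the upward and of the downward vertical rays from the
punctures, and their intersection is a disjoint union of `n + 1` vertical strips. For any such cover
(`TwoSetCover`) the obvious loops, one for each component of the intersection but one, generate
`π₁`, by subdividing paths (`TwoSetCover.ofFree_surjective`). There are no relations among them,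
because they act by left multiplication by the free generators on a fibre of the covering glued
along the intersection with the free group as fibre (`TwoSetCover.ofFree_injective`).

The iterated decomposition follows by induction on `n`, starting from `PB_1 = 1`.
-/

/-! ### Spaces covered by two simply connected open sets -/

open Path in
/-- Two paths with the same endpoints inside a simply connected set are homotopic. -/
theorem IsSimplyConnected.mk_eq_mk {X : Type*} [TopologicalSpace X] {U : Set X}
    (hU : IsSimplyConnected U) {x y : X} {γ γ' : Path x y} (h : ∀ t, γ t ∈ U)
    (h' : ∀ t, γ' t ∈ U) : Homotopic.Quotient.mk γ = Homotopic.Quotient.mk γ' := by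
  have := hU.simplyConnectedSpace
  have hx : x ∈ U := by simpa using h 0
  have hy : y ∈ U := by simpa using h 1
  let δ : Path (⟨x, hx⟩ : U) ⟨y, hy⟩ :=
    ⟨⟨fun t => ⟨γ t, h t⟩, by fun_prop⟩, by simp, by simp⟩
  let δ' : Path (⟨x, hx⟩ : U) ⟨y, hy⟩ :=
    ⟨⟨fun t => ⟨γ' t, h' t⟩, by fun_prop⟩, by simp, by simp⟩
  exact Homotopic.Quotient.eq.2
    ((SimplyConnectedSpace.paths_homotopic δ δ').map ⟨Subtype.val, continuous_subtype_val⟩)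

/-- Two open simply connected sets `U false`, `U true` covering `X`, whose intersection is the
disjoint union of the open path connected sets `S k`, where `k : Option ι`. -/
structure TwoSetCover (ι X : Type*) [TopologicalSpace X] where
  U : Bool → Set X
  isOpen_U : ∀ i, IsOpen (U i)
  cover : ∀ x, ∃ i, x ∈ U i
  simplyConnected : ∀ i, IsSimplyConnected (U i)
  S : Option ι → Set X
  isOpen_S : ∀ k, IsOpen (S k)
  pathConnected : ∀ k, IsPathConnected (S k)
  disjoint : ∀ k l x, x ∈ S k → x ∈ S l → k = l
  inter : ∀ x, (∀ i, x ∈ U i) ↔ ∃ k, x ∈ S k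

namespace TwoSetCover

variable {ι X : Type*} [TopologicalSpace X] (C : TwoSetCover ι X)

theorem mem_U {k : Option ι} {x : X} (hx : x ∈ C.S k) (i : Bool) : x ∈ C.U i :=
  (C.inter x).2 ⟨k, hx⟩ i

open Path

/-- The homotopy class of the paths from `x` to `y` inside the simply connected set `U i`. -/
noncomputable def arc (i : Bool) {x y : X} (hx : x ∈ C.U i) (hy : y ∈ C.U i) :
    Homotopic.Quotient x y :=
  Homotopic.Quotient.mk ((C.simplyConnected i).isPathConnected.joinedIn x hx y hy).somePath

theorem mk_eq_arc (i : Bool) {x y : X} (hx : x ∈ C.U i) (hy : y ∈ C.U i) (γ : Path x y)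
    (h : ∀ t, γ t ∈ C.U i) : Homotopic.Quotient.mk γ = C.arc i hx hy :=
  (C.simplyConnected i).mk_eq_mk h
    ((C.simplyConnected i).isPathConnected.joinedIn x hx y hy).somePath_mem

theorem exists_mk_eq_arc (i : Bool) {x y : X} (hx : x ∈ C.U i) (hy : y ∈ C.U i) :
    ∃ γ : Path x y, (∀ t, γ t ∈ C.U i) ∧ Homotopic.Quotient.mk γ = C.arc i hx hy :=
  ⟨_, ((C.simplyConnected i).isPathConnected.joinedIn x hx y hy).somePath_mem, rfl⟩

theorem arc_trans_arc (i : Bool) {x y z : X} (hx : x ∈ C.U i) (hy : y ∈ C.U i)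
    (hz : z ∈ C.U i) : (C.arc i hx hy).trans (C.arc i hy hz) = C.arc i hx hz := by
  obtain ⟨γ, hγ, e⟩ := C.exists_mk_eq_arc i hx hy
  obtain ⟨δ, hδ, e'⟩ := C.exists_mk_eq_arc i hy hz
  rw [← e, ← e', ← Homotopic.Quotient.mk_trans]
  refine C.mk_eq_arc i hx hz _ fun t => ?_
  have : γ.trans δ t ∈ Set.range (γ.trans δ) := ⟨t, rfl⟩
  rw [Path.trans_range] at this
  rcases this with ⟨s, hs⟩ | ⟨s, hs⟩
  · exact hs ▸ hγ s
  · exact hs ▸ hδ s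

theorem arc_self (i : Bool) {x : X} (hx : x ∈ C.U i) : C.arc i hx hx = Homotopic.Quotient.refl x :=
  (C.mk_eq_arc i hx hx (Path.refl x) fun _ => hx).symm

/-- Inside one component of the intersection the two arcs agree. -/
theorem arc_eq_arc {k : Option ι} {x y : X} (hx : x ∈ C.S k) (hy : y ∈ C.S k) (i j : Bool) :
    C.arc i (C.mem_U hx i) (C.mem_U hy i) = C.arc j (C.mem_U hx j) (C.mem_U hy j) := by
  obtain ⟨γ, hγ⟩ := (C.pathConnected k).joinedIn x hx y hy
  rw [← C.mk_eq_arc i _ _ γ fun t => C.mem_U (hγ t) i,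
    ← C.mk_eq_arc j _ _ γ fun t => C.mem_U (hγ t) j]

variable {x₀ : X} (h₀ : x₀ ∈ C.S none)

/-- A point of the component `S k`. -/
noncomputable def pt (k : Option ι) : X := (C.pathConnected k).nonempty.some

theorem pt_mem (k : Option ι) : C.pt k ∈ C.S k := (C.pathConnected k).nonempty.some_mem

/-- The loop which goes from `x₀` to `S k` inside `U false` and comes back inside `U true`. -/
noncomputable def loop (k : Option ι) : FundamentalGroup X x₀ :=
  (C.arc false (C.mem_U h₀ _) (C.mem_U (C.pt_mem k) _)).trans
    (C.arc true (C.mem_U (C.pt_mem k) _) (C.mem_U h₀ _))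

/-- The homomorphism from the free group given by the loops `loop (some k)`. -/
noncomputable def ofFree : FreeGroup ι →* FundamentalGroup X x₀ :=
  FreeGroup.lift fun k => C.loop h₀ (some k)

theorem arc_trans_arc_eq_loop {k : Option ι} {x : X} (hx : x ∈ C.S k) :
    (C.arc false (C.mem_U h₀ _) (C.mem_U hx _)).trans
      (C.arc true (C.mem_U hx _) (C.mem_U h₀ _)) = C.loop h₀ k := by
  rw [← C.arc_trans_arc false (C.mem_U h₀ _) (C.mem_U (C.pt_mem k) _) (C.mem_U hx _),
    Homotopic.Quotient.trans_assoc, C.arc_eq_arc (C.pt_mem k) hx false true, C.arc_trans_arc, loop]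

theorem arc_trans_arc_eq_loop_inv {k : Option ι} {x : X} (hx : x ∈ C.S k) :
    (C.arc true (C.mem_U h₀ _) (C.mem_U hx _)).trans
      (C.arc false (C.mem_U hx _) (C.mem_U h₀ _)) = (C.loop h₀ k)⁻¹ := by
  refine eq_inv_of_mul_eq_one_right (α := FundamentalGroup X x₀) ?_
  rw [← C.arc_trans_arc_eq_loop h₀ hx, FundamentalGroup.mul_def,
    Homotopic.Quotient.trans_assoc, ← Homotopic.Quotient.trans_assoc (C.arc false _ _), C.arc_trans_arc, C.arc_self,
    Homotopic.Quotient.refl_trans, C.arc_trans_arc, C.arc_self]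
  rfl

theorem loop_mem_range (k : Option ι) : C.loop h₀ k ∈ (C.ofFree h₀).range := by
  cases k with
  | none =>
    rw [← C.arc_trans_arc_eq_loop h₀ h₀, C.arc_self, C.arc_self, Homotopic.Quotient.refl_trans]
    exact one_mem _
  | some k => exact ⟨FreeGroup.of k, by simp [ofFree]⟩

/-- The class `g` of paths starting at `x₀` is a product of loops in the range of
`ofFree` followed by an arc inside `U i`. -/
def IsReduced (i : Bool) {x : X} (hx : x ∈ C.U i) (g : Homotopic.Quotient x₀ x) : Prop :=
  ∃ w : FundamentalGroup X x₀, w ∈ (C.ofFree h₀).range ∧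
    g = Homotopic.Quotient.trans (w : Homotopic.Quotient x₀ x₀) (C.arc i (C.mem_U h₀ i) hx)

variable {C h₀}

/-- On the intersection, changing the set in which the final arc runs costs one of the loops
`loop k` or its inverse. -/
theorem IsReduced.change {i j : Bool} {x : X} {hx : x ∈ C.U i} {g : Homotopic.Quotient x₀ x}
    (h : C.IsReduced h₀ i hx g) (hx' : x ∈ C.U j) : C.IsReduced h₀ j hx' g := by
  rcases eq_or_ne i j with rfl | hij
  · exact h
  obtain ⟨k, hk⟩ := (C.inter x).1 fun l => by
    rcases Bool.eq_or_eq_not l i with rfl | rfl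
    · exact hx
    · have : j = !i := by cases i <;> cases j <;> simp_all
      exact this ▸ hx'
  obtain ⟨w, hw, rfl⟩ := h
  have key : ∀ v : FundamentalGroup X x₀, v ∈ (C.ofFree h₀).range →
      (C.arc i (C.mem_U h₀ i) hx).trans (C.arc j hx' (C.mem_U h₀ j)) = v →
      C.IsReduced h₀ j hx'
        (Homotopic.Quotient.trans (w : Homotopic.Quotient x₀ x₀) (C.arc i (C.mem_U h₀ i) hx)) := by
    intro v hv e
    refine ⟨v * w, mul_mem hv hw, ?_⟩
    rw [FundamentalGroup.mul_def, ← e]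
    simp only [Homotopic.Quotient.trans_assoc, C.arc_trans_arc, C.arc_self, Homotopic.Quotient.trans_refl]
  cases i <;> cases j
  · exact absurd rfl hij
  · exact key _ (C.loop_mem_range h₀ k) (C.arc_trans_arc_eq_loop h₀ hk)
  · exact key _ (inv_mem (C.loop_mem_range h₀ k)) (C.arc_trans_arc_eq_loop_inv h₀ hk)
  · exact absurd rfl hij

theorem IsReduced.cast {i : Bool} {x : X} {hx : x ∈ C.U i} {g : Homotopic.Quotient x₀ x}
    (e : x = x₀) (h : C.IsReduced h₀ i hx g) :
    (g.cast rfl e.symm : FundamentalGroup X x₀) ∈ (C.ofFree h₀).range := by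
  subst e
  obtain ⟨w, hw, rfl⟩ := h
  rwa [C.arc_self, Homotopic.Quotient.trans_refl, Homotopic.Quotient.cast_rfl_rfl]

variable (C h₀)

/-- The initial segments of a subdivided path are reduced, by induction on their number of
pieces. -/
theorem ofFree_surjective : Function.Surjective (C.ofFree h₀) := by
  intro g
  obtain ⟨γ, rfl⟩ := Homotopic.Quotient.mk_surjective g
  obtain ⟨t, t0, tmono, ⟨m, hm⟩, ht⟩ := exists_monotone_Icc_subset_open_cover_unitInterval
    (c := fun i => γ ⁻¹' C.U i) (fun i => (C.isOpen_U i).preimage γ.continuous)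
    fun s _ => Set.mem_iUnion.2 (C.cover (γ s))
  choose i hi using ht
  -- the `k`-th piece of the subdivided path lies in `U (i k)`
  have h0 : ∀ k, γ (t k) ∈ C.U (i k) := fun k => hi k ⟨le_rfl, tmono k.le_succ⟩
  have h1 : ∀ k, γ (t (k + 1)) ∈ C.U (i k) := fun k => hi k ⟨tmono k.le_succ, le_rfl⟩
  let γ' : ∀ s, Path x₀ (γ s) := fun s => (γ.subpath 0 s).cast γ.source.symm rfl
  have key : ∀ k, C.IsReduced h₀ (i k) (h0 k) (Homotopic.Quotient.mk (γ' (t k))) := by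
    intro k
    induction k with
    | zero =>
      refine ⟨1, one_mem _, ?_⟩
      have := C.mk_eq_arc (i 0) (C.mem_U h₀ _) (h0 0) (γ' (t 0)) fun s => by
        have hs : ∀ r, r = 0 → γ' r s = γ 0 := by rintro r rfl; simp [γ']
        rw [hs _ t0, γ.source]; exact C.mem_U h₀ _
      rw [this]
      exact (Homotopic.Quotient.refl_trans _).symm
    | succ k ih =>
      refine IsReduced.change (hx := h1 k) ?_ _
      obtain ⟨w, hw, e⟩ := ih
      refine ⟨w, hw, ?_⟩
      rw [← C.arc_trans_arc (i k) _ (h0 k) (h1 k), ← Homotopic.Quotient.trans_assoc, ← e,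
        ← C.mk_eq_arc (i k) (h0 k) (h1 k) (γ.subpath (t k) (t (k + 1))),
        ← Homotopic.Quotient.mk_trans]
      · refine Homotopic.Quotient.eq.2 ⟨?_⟩
        exact ((Path.Homotopy.subpathTransSubpath γ 0 (t k) (t (k + 1))).symm.pathCast
          γ.source.symm rfl)
      · intro s
        have : γ.subpath (t k) (t (k + 1)) s ∈ Set.range (γ.subpath (t k) (t (k + 1))) := ⟨s, rfl⟩
        rw [Path.range_subpath_of_le _ _ _ (tmono k.le_succ)] at this
        obtain ⟨r, hr, e⟩ := this
        exact e ▸ hi k hr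
  have end_one : ∀ s (_ : s = 1) (hs : γ s ∈ C.U false) (e : γ s = x₀),
      C.IsReduced h₀ false hs (Homotopic.Quotient.mk (γ' s)) →
        (Homotopic.Quotient.mk γ : FundamentalGroup X x₀) ∈ (C.ofFree h₀).range := by
    rintro s rfl hs e ⟨w, hw, h⟩
    have h' := IsReduced.cast e ⟨w, hw, h⟩
    convert h' using 1
    rw [← Homotopic.Quotient.mk_cast]
    congr 1
    ext r
    simp [γ', Path.subpath_zero_one]
  have hm1 : t m = 1 := hm m le_rfl
  have e : γ (t m) = x₀ := by rw [hm1, γ.target]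
  exact end_one _ hm1 (e.symm ▸ C.mem_U h₀ _) e (IsReduced.change (key m) _)

/-! ### The covering which detects the free generators -/

open Classical in
/-- The locally constant transition function of the covering: it is the `k`-th free generator
on `S (some k)` and trivial on `S none`. -/
noncomputable def transition (x : X) : FreeGroup ι :=
  if h : ∃ k, x ∈ C.S (some k) then FreeGroup.of h.choose else 1

theorem transition_some {k : ι} {x : X} (hx : x ∈ C.S (some k)) :
    C.transition x = FreeGroup.of k := by
  have h : ∃ k, x ∈ C.S (some k) := ⟨k, hx⟩
  rw [transition, dif_pos h, Option.some_injective _ (C.disjoint _ _ x h.choose_spec hx)]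

theorem transition_none {x : X} (hx : x ∈ C.S none) : C.transition x = 1 :=
  dif_neg fun ⟨_, hk⟩ => nomatch C.disjoint _ _ x hx hk

theorem transition_eq {k : Option ι} {x y : X} (hx : x ∈ C.S k) (hy : y ∈ C.S k) :
    C.transition x = C.transition y := by
  cases k with
  | none => rw [C.transition_none hx, C.transition_none hy]
  | some k => rw [C.transition_some hx, C.transition_some hy]

theorem continuousAt_transition [TopologicalSpace (FreeGroup ι)] {x : X}
    (hx : ∀ i, x ∈ C.U i) : ContinuousAt C.transition x := by
  obtain ⟨k, hk⟩ := (C.inter x).1 hx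
  refine (continuousAt_const (y := C.transition x)).congr ?_
  filter_upwards [(C.isOpen_S k).mem_nhds hk] with y hy using C.transition_eq hk hy

section Monodromy

variable [TopologicalSpace (FreeGroup ι)] [DiscreteTopology (FreeGroup ι)]

/-- The bundle with fibre the discrete space `FreeGroup ι`, glued from `U false × FreeGroup ι` and
`U true × FreeGroup ι` by left multiplication with `transition`. -/
noncomputable def bundle : FiberBundleCore Bool X (FreeGroup ι) where
  baseSet := C.U
  isOpen_baseSet := C.isOpen_U
  indexAt x := (C.cover x).choose
  mem_baseSet_at x := (C.cover x).choose_spec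
  coordChange
    | false, true => fun x v => C.transition x * v
    | true, false => fun x v => (C.transition x)⁻¹ * v
    | _, _ => fun _ v => v
  coordChange_self i x _ v := by cases i <;> rfl
  continuousOn_coordChange i j := by
    have key : ∀ p : X × FreeGroup ι, (∀ i, p.1 ∈ C.U i) →
        ContinuousAt (fun p : X × FreeGroup ι => C.transition p.1) p := fun p hp =>
      (C.continuousAt_transition hp).comp continuousAt_fst
    rintro p ⟨⟨h1, h2⟩, -⟩
    refine ContinuousAt.continuousWithinAt ?_
    cases i <;> cases j
    · exact continuousAt_snd
    · exact (key p fun i => by cases i <;> assumption).mul continuousAt_snd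
    · exact (key p fun i => by cases i <;> assumption).inv.mul continuousAt_snd
    · exact continuousAt_snd
  coordChange_comp i j k x _ v := by cases i <;> cases j <;> cases k <;> simp

theorem isCoveringMap_proj : IsCoveringMap C.bundle.proj :=
  FiberBundle.isCoveringMap (F := FreeGroup ι) (E := C.bundle.Fiber)

/-- The point of the bundle over `x ∈ U i` with coordinate `g` in the `i`-th chart. -/
noncomputable def point (i : Bool) (x : X) (g : FreeGroup ι) : C.bundle.proj ⁻¹' {x} :=
  ⟨⟨x, C.bundle.coordChange i (C.bundle.indexAt x) x g⟩, rfl⟩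

theorem point_false {x : X} (hx : ∀ i, x ∈ C.U i) (g : FreeGroup ι) :
    C.point false x g = C.point true x (C.transition x * g) := by
  refine Subtype.ext (congrArg (Bundle.TotalSpace.mk x) ?_)
  exact (C.bundle.coordChange_comp false true _ x
    ⟨⟨hx _, hx _⟩, C.bundle.mem_baseSet_at x⟩ g).symm

theorem point_injective {i : Bool} {x : X} (hx : x ∈ C.U i) :
    Function.Injective (C.point i x) := by
  intro g g' h
  have h' : C.bundle.coordChange i (C.bundle.indexAt x) x g =
      C.bundle.coordChange i (C.bundle.indexAt x) x g' :=
    eq_of_heq (Bundle.TotalSpace.mk.inj (congrArg Subtype.val h)).2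
  have := congrArg (C.bundle.coordChange (C.bundle.indexAt x) i x) h'
  have hx' : x ∈ C.bundle.baseSet i := hx
  rwa [C.bundle.coordChange_comp _ _ _ _ ⟨⟨hx', C.bundle.mem_baseSet_at x⟩, hx'⟩,
    C.bundle.coordChange_comp _ _ _ _ ⟨⟨hx', C.bundle.mem_baseSet_at x⟩, hx'⟩,
    C.bundle.coordChange_self _ _ hx', C.bundle.coordChange_self _ _ hx'] at this

/-- Transport along an arc inside `U i` keeps the coordinate of the `i`-th chart. -/
theorem monodromy_arc (i : Bool) {x y : X} (hx : x ∈ C.U i) (hy : y ∈ C.U i)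
    (g : FreeGroup ι) :
    C.isCoveringMap_proj.monodromy (C.arc i hx hy) (C.point i x g) = C.point i y g := by
  obtain ⟨γ, hγ, e⟩ := C.exists_mk_eq_arc i hx hy
  rw [← e]
  have hc : Continuous fun t => (C.bundle.localTriv i).toOpenPartialHomeomorph.symm (γ t, g) :=
    (C.bundle.localTriv i).toOpenPartialHomeomorph.continuousOn_symm.comp_continuous (by fun_prop) fun t => by
      exact ((C.bundle.localTriv i).mem_target).2 (hγ t)
  let Γ : Path (C.point i x g).1 (C.point i y g).1 :=
    ⟨⟨_, hc⟩, by simp [point], by simp [point]⟩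
  refine C.isCoveringMap_proj.monodromy_eq_of_map_eq (Homotopic.Quotient.mk Γ) ?_
  exact congrArg Homotopic.Quotient.mk (Path.ext (funext fun t => rfl))

/-- The coordinate changes when the loop passes from `U false` to `U true` in `S (some k)`, and not
when it returns in `S none`. -/
theorem monodromy_loop (k : ι) (g : FreeGroup ι) :
    C.isCoveringMap_proj.monodromyPerm x₀ (C.loop h₀ (some k)) (C.point false x₀ g) =
      C.point false x₀ (FreeGroup.of k * g) := by
  have hk := C.pt_mem (some k)
  rw [IsCoveringMap.coe_monodromyPerm, loop, IsCoveringMap.monodromy_trans_apply,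
    monodromy_arc, C.point_false fun i => C.mem_U hk i, monodromy_arc, C.transition_some hk,
    C.point_false fun i => C.mem_U h₀ i, C.transition_none h₀, one_mul]

theorem monodromy_ofFree (w g : FreeGroup ι) :
    C.isCoveringMap_proj.monodromyPerm x₀ (C.ofFree h₀ w) (C.point false x₀ g) =
      C.point false x₀ (w * g) := by
  induction w using FreeGroup.induction_on generalizing g with
  | C1 => rw [map_one, map_one, Equiv.Perm.one_apply, one_mul]
  | of k => simpa [ofFree] using C.monodromy_loop h₀ k g
  | inv_of k ih =>
    rw [map_inv, map_inv, Equiv.Perm.inv_eq_iff_eq, ih, mul_inv_cancel_left]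
  | mul v w hv hw => rw [map_mul, map_mul, Equiv.Perm.mul_apply, hw, hv, mul_assoc]

end Monodromy

/-- A word is recovered from the monodromy of its loop, which sends the coordinate `1` to it. -/
theorem ofFree_injective : Function.Injective (C.ofFree h₀) := by
  let : TopologicalSpace (FreeGroup ι) := ⊥
  have : DiscreteTopology (FreeGroup ι) := ⟨rfl⟩
  refine (injective_iff_map_eq_one _).2 fun w hw => ?_
  have := C.monodromy_ofFree h₀ w 1
  rw [hw, map_one, Equiv.Perm.one_apply, mul_one] at this
  exact (C.point_injective (C.mem_U h₀ _) this).symm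

/-- The fundamental group of a space covered by two simply connected open sets is free on all but
one of the components of their intersection. -/
noncomputable def freeGroupEquiv : FreeGroup ι ≃* FundamentalGroup X x₀ :=
  MulEquiv.ofBijective (C.ofFree h₀) ⟨C.ofFree_injective h₀, C.ofFree_surjective h₀⟩

end TwoSetCover

/-! ### Parallel transport of points along moving configurations -/

/-- A map `ℂ → ℂ` which carries `z i` to `w i` and moves only the points at distance less than `δ`
from some `z i`. -/
noncomputable def push {n : ℕ} (δ : ℝ) (z w : Fin n → ℂ) (x : ℂ) : ℂ :=
  x + ∑ i, (max 0 (1 - ‖x - z i‖ / δ)) • (w i - z i)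

section Push

variable {n : ℕ} {δ : ℝ} {z w : Fin n → ℂ}

theorem push_self (x : ℂ) : push δ z z x = x := by simp [push]

theorem push_apply_point (hδ : 0 < δ) (hz : ∀ i j, i ≠ j → δ ≤ ‖z i - z j‖) (i : Fin n) :
    push δ z w (z i) = w i := by
  rw [push, Finset.sum_eq_single i]
  · simp
  · intro j _ hj
    have : 1 ≤ ‖z i - z j‖ / δ := (one_le_div hδ).2 (hz i j hj.symm)
    rw [max_eq_left (by linarith), zero_smul]
  · simp

/-- The map `push δ z w` separates `z i` from all other points: it is the identity plus a map with
Lipschitz constant less than `1`. -/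
theorem push_ne (hδ : 0 < δ) (hz : ∀ i j, i ≠ j → δ ≤ ‖z i - z j‖)
    (hw : ∑ i, ‖w i - z i‖ < δ) {x : ℂ} {i : Fin n} (hx : x ≠ z i) : push δ z w x ≠ w i := by
  intro h
  have hpos : 0 < ‖x - z i‖ := norm_pos_iff.2 (sub_ne_zero.2 hx)
  set χ : ℂ → Fin n → ℝ := fun y j => max 0 (1 - ‖y - z j‖ / δ) with hχ
  have hlip : ∀ j, |χ (z i) j - χ x j| ≤ ‖x - z i‖ / δ := fun j => by
    refine (abs_max_sub_max_le_max _ _ _ _).trans ?_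
    rw [sub_zero, abs_zero, max_eq_right (abs_nonneg _)]
    have : (1 - ‖z i - z j‖ / δ) - (1 - ‖x - z j‖ / δ) = (‖x - z j‖ - ‖z i - z j‖) / δ := by ring
    rw [this, abs_div, abs_of_pos hδ]
    gcongr
    simpa using abs_norm_sub_norm_le (x - z j) (z i - z j)
  have e : x - z i = ∑ j, (χ (z i) j - χ x j) • (w j - z j) := by
    have h' := h.trans (push_apply_point (w := w) hδ hz i).symm
    simp only [push] at h'
    simp only [sub_smul, Finset.sum_sub_distrib, hχ]
    linear_combination h'
  have : ‖x - z i‖ ≤ ‖x - z i‖ / δ * ∑ j, ‖w j - z j‖ := by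
    rw [Finset.mul_sum]
    conv_lhs => rw [e]
    refine norm_sum_le_of_le _ fun j _ => ?_
    rw [norm_smul, Real.norm_eq_abs]
    gcongr
    exact hlip j
  have h2 : ‖x - z i‖ / δ * ∑ j, ‖w j - z j‖ < ‖x - z i‖ / δ * δ := by gcongr
  rw [div_mul_cancel₀ _ hδ.ne'] at h2
  linarith

end Push

section Transport

open unitInterval

variable {n : ℕ} {X : Type*}

/-- The distances between the points of configurations in a compact family are bounded below. -/
theorem ConfSpace.exists_separation [TopologicalSpace X] [CompactSpace X]
    (H : C(X, ConfSpace n)) :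
    ∃ δ > 0, ∀ x i j, i ≠ j → δ ≤ ‖(H x).1 i - (H x).1 j‖ := by
  let f : X × {p : Fin n × Fin n // p.1 ≠ p.2} → ℝ := fun q =>
    ‖(H q.1).1 q.2.1.1 - (H q.1).1 q.2.1.2‖
  have hf : Continuous f := by
    refine continuous_prod_of_discrete_right.2 fun p => ?_
    have hc : ∀ k : Fin n, Continuous fun x => (H x).1 k := fun k =>
      (continuous_apply k).comp (continuous_subtype_val.comp H.continuous)
    exact ((hc p.1.1).sub (hc p.1.2)).norm
  rcases isEmpty_or_nonempty (X × {p : Fin n × Fin n // p.1 ≠ p.2}) with he | he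
  · exact ⟨1, one_pos, fun x i j hij => (he.false (x, ⟨(i, j), hij⟩)).elim⟩
  · obtain ⟨q, -, hq⟩ := isCompact_univ.exists_isMinOn Set.univ_nonempty hf.continuousOn
    exact ⟨f q, norm_pos_iff.2 (sub_ne_zero.2 ((H q.1).2 _ _ q.2.2)),
      fun x i j hij => isMinOn_iff.1 hq (x, ⟨(i, j), hij⟩) (Set.mem_univ _)⟩

/-- The time `min t (k / N)` of the unit interval. -/
noncomputable def stopTime (N k : ℕ) (t : I) : I :=
  Set.projIcc 0 1 zero_le_one (min (t : ℝ) (k / N))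

theorem continuous_stopTime (N k : ℕ) : Continuous (stopTime N k) :=
  continuous_projIcc.comp (by fun_prop)

theorem stopTime_zero_right (N k : ℕ) : stopTime N k 0 = 0 := by
  have : (0 : ℝ) ≤ k / N := by positivity
  rw [stopTime, Set.Icc.coe_zero, min_eq_left this]
  simp

theorem stopTime_zero_left (N : ℕ) (t : I) : stopTime N 0 t = 0 := by
  rw [stopTime, Nat.cast_zero, zero_div, min_eq_right t.2.1]
  simp

theorem stopTime_self {N : ℕ} (hN : N ≠ 0) (t : I) : stopTime N N t = t := by
  rw [stopTime, div_self (Nat.cast_ne_zero.2 hN), min_eq_left t.2.2, Set.projIcc_val]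

theorem dist_stopTime_succ_le (N k : ℕ) (t : I) :
    dist (stopTime N (k + 1) t) (stopTime N k t) ≤ 1 / N := by
  rw [Subtype.dist_eq, Real.dist_eq]
  refine (Set.abs_projIcc_sub_projIcc zero_le_one).trans ?_
  refine (abs_min_sub_min_le_max _ _ _ _).trans ?_
  rw [sub_self, abs_zero, max_eq_right (abs_nonneg _), Nat.cast_succ, ← sub_div,
    add_sub_cancel_left, abs_of_nonneg (by positivity)]

/-- The `k`-th stage of parallel transport along the paths `t ↦ H (x, t)`, followed up to the time
`k / N`: an iteration of the maps `push` along the subdivision into `N` steps. -/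
noncomputable def transportAux [TopologicalSpace X] (H : C(X × I, ConfSpace n)) (δ : ℝ) (N : ℕ) :
    ℕ → X × I × ℂ → ℂ
  | 0, q => q.2.2
  | k + 1, q => push δ (H (q.1, stopTime N k q.2.1)).1 (H (q.1, stopTime N (k + 1) q.2.1)).1
      (transportAux H δ N k q)

theorem continuous_transportAux [TopologicalSpace X] (H : C(X × I, ConfSpace n)) (δ : ℝ)
    (N k : ℕ) : Continuous (transportAux H δ N k) := by
  induction k with
  | zero => exact continuous_snd.comp continuous_snd
  | succ k ih =>
    have hc : ∀ (l : ℕ) (i : Fin n),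
        Continuous fun q : X × I × ℂ => (H (q.1, stopTime N l q.2.1)).1 i := fun l i =>
      (continuous_apply i).comp (continuous_subtype_val.comp (H.continuous.comp
        (continuous_fst.prodMk ((continuous_stopTime N l).comp
          (continuous_fst.comp continuous_snd)))))
    simp only [transportAux, push]
    refine ih.add (continuous_finsetSum _ fun i _ => ?_)
    exact (continuous_const.max (continuous_const.sub
      ((ih.sub (hc k i)).norm.div_const δ))).smul ((hc (k + 1) i).sub (hc k i))

theorem transportAux_eq [TopologicalSpace X] (H : C(X × I, ConfSpace n)) (δ : ℝ) (N k : ℕ)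
    {q : X × I × ℂ} (h : ∀ l, H (q.1, stopTime N l q.2.1) = H (q.1, 0)) :
    transportAux H δ N k q = q.2.2 := by
  induction k with
  | zero => rfl
  | succ k ih => rw [transportAux, h, h, push_self, ih]

/-- **Parallel transport.** Over a compact parameter space, a continuous family of paths of
configurations can be followed by maps of the plane which avoid the moving configuration. -/
theorem ConfSpace.exists_transport [PseudoMetricSpace X] [CompactSpace X]
    (H : C(X × I, ConfSpace n)) :
    ∃ P : X × I × ℂ → ℂ, Continuous P ∧ (∀ x y, P (x, 0, y) = y) ∧
      (∀ x t y, (∀ i, y ≠ (H (x, 0)).1 i) → ∀ i, P (x, t, y) ≠ (H (x, t)).1 i) ∧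
      ∀ x, (∀ t, H (x, t) = H (x, 0)) → ∀ t y, P (x, t, y) = y := by
  obtain ⟨δ, hδ, hsep⟩ := ConfSpace.exists_separation H
  have hn : (0 : ℝ) < n + 1 := by positivity
  -- moving each of the `n` points by at most `δ / (n + 1)` moves them by less than `δ` in total
  obtain ⟨η, hη, hH⟩ := Metric.uniformContinuous_iff.1
    (CompactSpace.uniformContinuous_of_continuous H.continuous) (δ / (n + 1)) (div_pos hδ hn)
  obtain ⟨m, hm⟩ := exists_nat_one_div_lt hη
  set N := m + 1
  refine ⟨transportAux H δ N N, continuous_transportAux H δ N N, fun x y => ?_,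
    fun x t y hy => ?_, fun x hx t y => ?_⟩
  · exact transportAux_eq H δ N N fun l => by rw [stopTime_zero_right]
  · have key : ∀ k, ∀ i, transportAux H δ N k (x, t, y) ≠ (H (x, stopTime N k t)).1 i := by
      intro k
      induction k with
      | zero => simpa [transportAux, stopTime_zero_left] using hy
      | succ k ih =>
        refine fun i => push_ne hδ (hsep _) ?_ (ih i)
        have hd : dist (H (x, stopTime N (k + 1) t)) (H (x, stopTime N k t)) < δ / (n + 1) := by
          refine hH ?_
          rw [Prod.dist_eq, dist_self, max_eq_right dist_nonneg]
          refine (dist_stopTime_succ_le N k t).trans_lt ?_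
          simpa [N] using hm
        have hb : ∀ j, ‖(H (x, stopTime N (k + 1) t)).1 j - (H (x, stopTime N k t)).1 j‖ ≤
            δ / (n + 1) := fun j => by
          rw [← dist_eq_norm]
          exact (dist_le_pi_dist _ _ j).trans hd.le
        refine (Finset.sum_le_sum fun j _ => hb j).trans_lt ?_
        rw [Finset.sum_const, Finset.card_univ, Fintype.card_fin, nsmul_eq_mul, mul_div_assoc',
          div_lt_iff₀ hn]
        nlinarith
    intro i
    simpa [stopTime_self (N := N) (Nat.succ_ne_zero m)] using key N i
  · exact transportAux_eq H δ N N fun l => hx _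

end Transport

/-! ### The fibre of the forgetful map -/

section Fiber

open unitInterval

variable {n : ℕ}

/-- The plane with the points of the configuration `p` removed: the fibre of `forgetLast n` over
`p`. -/
abbrev PuncturedPlane (p : ConfSpace n) : Type := {x : ℂ // ∀ i, x ≠ p.1 i}

/-- The configuration `(z₁, …, z_n, x)`. -/
def ConfSpace.snoc (p : ConfSpace n) (x : ℂ) (hx : ∀ i, x ≠ p.1 i) : ConfSpace (n + 1) :=
  ⟨Fin.snoc (α := fun _ => ℂ) p.1 x, by
    intro i j
    refine Fin.lastCases ?_ (fun i => ?_) i <;> refine Fin.lastCases ?_ (fun j => ?_) j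
    · exact fun h => absurd rfl h
    · intro _
      rw [Fin.snoc_last, Fin.snoc_castSucc]
      exact hx j
    · intro _
      rw [Fin.snoc_last, Fin.snoc_castSucc]
      exact (hx i).symm
    · intro h
      rw [Fin.snoc_castSucc, Fin.snoc_castSucc]
      exact p.2 i j fun hij => h (congrArg Fin.castSucc hij)⟩

theorem ConfSpace.continuous_snoc {X : Type*} [TopologicalSpace X] {p : X → ConfSpace n}
    {x : X → ℂ} (hp : Continuous p) (hx : Continuous x) (h : ∀ y i, x y ≠ (p y).1 i) :
    Continuous fun y => (p y).snoc (x y) (h y) := by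
  refine Continuous.subtype_mk (continuous_pi fun i => ?_) _
  refine Fin.lastCases ?_ (fun i => ?_) i
  · simpa only [Fin.snoc_last] using hx
  · simp only [Fin.snoc_castSucc]
    exact (continuous_apply i).comp (continuous_subtype_val.comp hp)

@[simp]
theorem forgetLast_snoc (p : ConfSpace n) (x : ℂ) (hx : ∀ i, x ≠ p.1 i) :
    forgetLast n (p.snoc x hx) = p :=
  Subtype.ext (funext fun i => Fin.snoc_castSucc (α := fun _ => ℂ) x p.1 i)

/-- The last point of a configuration. -/
def ConfSpace.last (q : ConfSpace (n + 1)) : ℂ := q.1 (Fin.last n)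

@[fun_prop]
theorem ConfSpace.continuous_last : Continuous (ConfSpace.last (n := n)) :=
  (continuous_apply _).comp continuous_subtype_val

@[simp]
theorem ConfSpace.last_snoc (p : ConfSpace n) (x : ℂ) (hx : ∀ i, x ≠ p.1 i) :
    (p.snoc x hx).last = x := Fin.snoc_last (α := fun _ => ℂ) x p.1

theorem ConfSpace.last_ne (q : ConfSpace (n + 1)) (i : Fin n) :
    q.last ≠ (forgetLast n q).1 i :=
  q.2 _ _ (Fin.castSucc_lt_last i).ne'

theorem ConfSpace.ext_last {q q' : ConfSpace (n + 1)} (h : forgetLast n q = forgetLast n q')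
    (h' : q.last = q'.last) : q = q' := by
  refine Subtype.ext (funext fun i => ?_)
  refine Fin.lastCases h' (fun i => ?_) i
  exact congrFun (congrArg Subtype.val h) i

/-- The inclusion of the fibre of `forgetLast n` over `p`. -/
def fiberInclusion (p : ConfSpace n) : C(PuncturedPlane p, ConfSpace (n + 1)) where
  toFun x := p.snoc x.1 x.2
  continuous_toFun :=
    ConfSpace.continuous_snoc continuous_const continuous_subtype_val fun x => x.2

@[simp]
theorem forgetLast_fiberInclusion (p : ConfSpace n) (x : PuncturedPlane p) :
    forgetLast n (fiberInclusion p x) = p := forgetLast_snoc p x.1 x.2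

@[simp]
theorem last_fiberInclusion (p : ConfSpace n) (x : PuncturedPlane p) :
    (fiberInclusion p x).last = x.1 := ConfSpace.last_snoc p x.1 x.2

theorem forgetLast_addPoint (p : ConfSpace n) : forgetLast n (addPoint n p) = p :=
  Subtype.ext (funext fun i => Fin.snoc_castSucc (α := fun _ => ℂ) _ p.1 i)

/-- The base point of the fibre over `p` given by the cross-section `addPoint n`. -/
noncomputable def sectionPoint (p : ConfSpace n) : PuncturedPlane p :=
  ⟨(((∑ j, ‖p.1 j‖) + 1 : ℝ) : ℂ), fun i => (ne_sum_norm_add_one p.1 i).symm⟩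

theorem map_forgetLast_map_fiberInclusion {p : ConfSpace n} {x₀ : PuncturedPlane p}
    (a : FundamentalGroup (PuncturedPlane p) x₀) :
    FundamentalGroup.map (forgetLast n) _ (FundamentalGroup.map (fiberInclusion p) x₀ a) = 1 := by
  obtain ⟨α, rfl⟩ := Path.Homotopic.Quotient.mk_surjective a
  refine congrArg Path.Homotopic.Quotient.mk (Path.ext (funext fun t => ?_))
  exact (forgetLast_fiberInclusion p (α t)).trans (forgetLast_fiberInclusion p x₀).symm

/-- A loop of configurations whose projection is null-homotopic can be deformed into the fibre:
the null-homotopy is lifted by parallel transport. -/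
theorem exists_map_fiberInclusion_eq {p : ConfSpace n} {x₀ : PuncturedPlane p}
    {g : PureBraidGroup (n + 1) (fiberInclusion p x₀)}
    (hg : FundamentalGroup.map (forgetLast n) _ g = 1) :
    ∃ a, FundamentalGroup.map (fiberInclusion p) x₀ a = g := by
  obtain ⟨γ, rfl⟩ := Path.Homotopic.Quotient.mk_surjective g
  obtain ⟨K⟩ : (γ.map (forgetLast n).continuous).Homotopic (Path.refl _) :=
    Path.Homotopic.Quotient.exact hg
  obtain ⟨P, hP, hP0, hPne, hPc⟩ := ConfSpace.exists_transport
    (X := I) (⟨fun st => K (st.2, st.1), by fun_prop⟩ : C(I × I, ConfSpace n))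
  have hK0 : ∀ s, K (0, s) = forgetLast n (γ s) := fun s => by simp
  have hK1 : ∀ s, K (1, s) = p := fun s => by simp
  have hKs : ∀ t s, s = 0 ∨ s = 1 → K (t, s) = p := fun t s hs => by
    rcases hs with rfl | rfl <;> simp
  have hne : ∀ s t i, P (s, t, (γ s).last) ≠ (K (t, s)).1 i := fun s t =>
    hPne s t _ fun i => by
      change (γ s).last ≠ (K (0, s)).1 i
      rw [hK0]
      exact (γ s).last_ne i
  have hγ : ∀ s, s = 0 ∨ s = 1 → γ s = fiberInclusion p x₀ := fun s hs => by
    rcases hs with rfl | rfl <;> simp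
  have hend : ∀ s t, s = 0 ∨ s = 1 → P (s, t, (γ s).last) = x₀.1 := fun s t hs => by
    rw [hPc s (fun t => by simp [hKs _ s hs]), hγ s hs, last_fiberInclusion]
  have hc : Continuous fun s => P (s, 1, (γ s).last) := by fun_prop
  have hα : ∀ s i, P (s, 1, (γ s).last) ≠ p.1 i := fun s => by
    have := hne s 1
    rwa [hK1] at this
  let α : Path x₀ x₀ :=
    ⟨⟨fun s => ⟨P (s, 1, (γ s).last), hα s⟩, hc.subtype_mk _⟩,
      Subtype.ext (hend 0 1 (.inl rfl)), Subtype.ext (hend 1 1 (.inr rfl))⟩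
  refine ⟨Path.Homotopic.Quotient.mk α, Path.Homotopic.Quotient.eq.2 (Path.Homotopic.symm ⟨?_⟩)⟩
  refine
    { toFun := fun ts => (K ts).snoc (P (ts.2, ts.1, (γ ts.2).last)) (hne ts.2 ts.1)
      continuous_toFun := ConfSpace.continuous_snoc K.continuous (by fun_prop) _
      map_zero_left := fun s => ConfSpace.ext_last ?_ ?_
      map_one_left := fun s => ConfSpace.ext_last ?_ ?_
      prop' := fun t s hs => ConfSpace.ext_last ?_ ?_ }
  · rw [forgetLast_snoc]; exact hK0 s
  · rw [ConfSpace.last_snoc]; exact hP0 s _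
  · rw [forgetLast_snoc]; exact (hK1 s).trans (forgetLast_fiberInclusion p (α s)).symm
  · rw [ConfSpace.last_snoc]; exact (last_fiberInclusion p (α s)).symm
  · refine (forgetLast_snoc _ _ (hne s t)).trans ((hKs t s hs).trans ?_)
    change p = forgetLast n (γ s)
    rw [hγ s hs, forgetLast_fiberInclusion]
  · refine (ConfSpace.last_snoc _ _ (hne s t)).trans ((hend s t hs).trans ?_)
    change x₀.1 = (γ s).last
    rw [hγ s hs, last_fiberInclusion]

/-- The fundamental group of the fibre injects. Transporting a null-homotopy `K` of a loop `α` of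
the fibre, and `addPoint ∘ forgetLast ∘ K`, back to the fibre gives homotopies from `α` and from
the constant loop to the same loop. -/
theorem map_fiberInclusion_injective (p : ConfSpace n) :
    Function.Injective (FundamentalGroup.map (fiberInclusion p) (sectionPoint p)) := by
  refine (injective_iff_map_eq_one _).2 fun a ha => ?_
  obtain ⟨α, rfl⟩ := Path.Homotopic.Quotient.mk_surjective a
  obtain ⟨K⟩ : (α.map (fiberInclusion p).continuous).Homotopic (Path.refl _) :=
    Path.Homotopic.Quotient.exact ha
  have hK0 : ∀ s, K (0, s) = fiberInclusion p (α s) := fun s => by simp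
  have hK1 : ∀ s, K (1, s) = fiberInclusion p (sectionPoint p) := fun s => by simp
  have hKs : ∀ t s, s = 0 ∨ s = 1 → K (t, s) = fiberInclusion p (sectionPoint p) :=
    fun t s hs => by rcases hs with rfl | rfl <;> simp
  -- the path `r ↦ forgetLast (K (t (1 - r), s))` leads from `forgetLast (K (t, s))` back to `p`
  obtain ⟨P, hP, hP0, hPne, hPc⟩ := ConfSpace.exists_transport (X := I × I)
    (⟨fun x => forgetLast n (K (x.1.1 * σ x.2, x.1.2)), by fun_prop⟩ :
      C((I × I) × I, ConfSpace n))
  have hne : ∀ (x : I × I) y, (∀ i, y ≠ (forgetLast n (K x)).1 i) →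
      ∀ i, P (x, 1, y) ≠ p.1 i := fun x y hy i => by
    have h1 := hPne x 1 y (fun i => by simpa using hy i) i
    have h2 : forgetLast n (K (x.1 * σ 1, x.2)) = p := by simp
    change P (x, 1, y) ≠ (forgetLast n (K (x.1 * σ 1, x.2))).1 i at h1
    rwa [h2] at h1
  have hzero : ∀ s y, P ((0, s), 1, y) = y := fun s y =>
    hPc (0, s) (fun r => by simp) 1 y
  have hend : ∀ t s y, s = 0 ∨ s = 1 → P ((t, s), 1, y) = y := fun t s y hs =>
    hPc (t, s) (fun r => by simp [hKs _ s hs]) 1 y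
  have hlast : ∀ x i, P (x, 1, (K x).last) ≠ p.1 i := fun x => hne x _ (K x).last_ne
  have hsec : ∀ x i, P (x, 1, (sectionPoint (forgetLast n (K x))).1) ≠ p.1 i := fun x =>
    hne x _ (sectionPoint (forgetLast n (K x))).2
  have hq : ∀ s, P ((1, s), 1, (sectionPoint (forgetLast n (K (1, s)))).1) =
      P ((1, s), 1, (sectionPoint p).1) := fun s => by
    rw [hK1, forgetLast_fiberInclusion]
  have hcβ : Continuous fun s => P ((1, s), 1, (sectionPoint p).1) := by fun_prop
  let β : Path (sectionPoint p) (sectionPoint p) :=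
    ⟨⟨fun s => ⟨P ((1, s), 1, (sectionPoint p).1), fun i => hq s ▸ hsec (1, s) i⟩,
      hcβ.subtype_mk _⟩, Subtype.ext (hend _ _ _ (.inl rfl)), Subtype.ext (hend _ _ _ (.inr rfl))⟩
  have hαβ : α.Homotopic β := by
    have hc : Continuous fun x => P (x, 1, (K x).last) := by fun_prop
    refine ⟨{ toFun := fun x => ⟨P (x, 1, (K x).last), hlast x⟩
              continuous_toFun := hc.subtype_mk _
              map_zero_left := fun s => Subtype.ext ?_
              map_one_left := fun s => Subtype.ext ?_
              prop' := fun t s hs => Subtype.ext ?_ }⟩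
    · exact (hzero s _).trans (by rw [hK0, last_fiberInclusion]; rfl)
    · change P ((1, s), 1, (K (1, s)).last) = _
      rw [hK1, last_fiberInclusion]; rfl
    · refine (hend t s _ hs).trans ?_
      rw [hKs t s hs, last_fiberInclusion]
      rcases hs with rfl | rfl <;> simp
  have hβ : (Path.refl (sectionPoint p)).Homotopic β := by
    have hc' : Continuous fun r : ConfSpace n => (sectionPoint r).1 :=
      (ConfSpace.continuous_last.comp (addPoint n).continuous).congr fun r =>
        last_fiberInclusion r (sectionPoint r)
    have hf : Continuous fun x => forgetLast n (K x) := by fun_prop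
    have hsf := hc'.comp hf
    have hc : Continuous fun x => P (x, 1, (sectionPoint (forgetLast n (K x))).1) :=
      hP.comp (continuous_id.prodMk (continuous_const.prodMk hsf))
    refine ⟨{ toFun := fun x => ⟨P (x, 1, (sectionPoint (forgetLast n (K x))).1), hsec x⟩
              continuous_toFun := hc.subtype_mk _
              map_zero_left := fun s => Subtype.ext ?_
              map_one_left := fun s => Subtype.ext ?_
              prop' := fun t s hs => Subtype.ext ?_ }⟩
    · exact (hzero s _).trans (by rw [hK0, forgetLast_fiberInclusion]; rfl)
    · exact hq s
    · refine (hend t s _ hs).trans ?_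
      rw [hKs t s hs, forgetLast_fiberInclusion]; rfl
  exact Path.Homotopic.Quotient.eq.2 (hαβ.trans hβ.symm)

end Fiber

/-! ### The plane punctured at `0, …, n - 1` -/

section StandardConfiguration

open unitInterval

/-- The configuration `(0, 1, …, n - 1)`. -/
def stdConf (n : ℕ) : ConfSpace n :=
  ⟨fun k => ((k : ℕ) : ℂ), fun _ _ hij h => hij (Fin.ext (Nat.cast_injective h))⟩

/-- For `s = -1` (resp. `s = 1`), the plane without the closed vertical rays going up (resp. down)
from the points `0, …, n - 1`. -/
def slitPlane (n : ℕ) (s : ℝ) : Set ℂ := {x | ∀ k : Fin n, x.re = k → 0 < s * x.im}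

theorem isOpen_slitPlane (n : ℕ) (s : ℝ) : IsOpen (slitPlane n s) := by
  have : slitPlane n s = ⋂ k : Fin n, {x : ℂ | x.re ≠ k} ∪ {x : ℂ | 0 < s * x.im} := by
    ext x
    simp [slitPlane, imp_iff_not_or]
  rw [this]
  exact isOpen_iInter_of_finite fun k =>
    (isOpen_ne_fun Complex.continuous_re continuous_const).union
      (isOpen_lt continuous_const (continuous_const.mul Complex.continuous_im))

/-- The slit plane is first pushed vertically away from the rays into a half-plane, which is then
contracted to a point. -/
theorem isSimplyConnected_slitPlane (n : ℕ) {s : ℝ} (hs : s * s = 1) :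
    IsSimplyConnected (slitPlane n s) := by
  have hhalf : ∀ x : ℂ, 0 < s * x.im → x ∈ slitPlane n s := fun x hx _ _ => hx
  let c : slitPlane n s := ⟨s * Complex.I, hhalf _ (by simp [hs])⟩
  have hmem : ∀ (t : I) (x : slitPlane n s),
      x.1 + t * (s * (1 + |x.1.im|)) * Complex.I ∈ slitPlane n s := fun t x k hk => by
    have h := x.2 k (by simpa using hk)
    have : s * (x.1 + t * (s * (1 + |x.1.im|)) * Complex.I).im =
        s * x.1.im + s * s * (t * (1 + |x.1.im|)) := by
      simp; ring
    rw [this, hs]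
    have := t.2.1
    positivity
  have hpos : ∀ x : slitPlane n s,
      0 < s * (x.1 + (s * (1 + |x.1.im|)) * Complex.I).im := fun x => by
    have : s * (x.1 + (s * (1 + |x.1.im|)) * Complex.I).im =
        s * x.1.im + s * s * (1 + |x.1.im|) := by
      simp; ring
    rw [this, hs]
    have h1 : |s| = 1 := by
      rw [← sq_eq_sq₀ (abs_nonneg _) zero_le_one, sq_abs, one_pow, sq, hs]
    have := neg_abs_le (s * x.1.im)
    rw [abs_mul, h1, one_mul] at this
    linarith
  have hmem' : ∀ (t : I) (x : slitPlane n s),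
      (1 - t : ℂ) * (x.1 + (s * (1 + |x.1.im|)) * Complex.I) + t * (s * Complex.I) ∈
        slitPlane n s := fun t x => hhalf _ <| by
    have h := hpos x
    set y := x.1 + (s * (1 + |x.1.im|)) * Complex.I
    have : s * ((1 - t : ℂ) * y + t * (s * Complex.I)).im =
        (1 - t) * (s * y.im) + t * (s * s) := by
      simp; ring
    rw [this, hs]
    rcases t.2.1.eq_or_lt with h0 | h0
    · rw [← h0]; simpa using h
    · have := mul_nonneg (sub_nonneg.2 t.2.2) h.le
      linarith
  have : ContractibleSpace (slitPlane n s) := by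
    rw [contractible_iff_id_nullhomotopic]
    refine ⟨c, ContinuousMap.Homotopic.trans
      (g := ⟨fun x => ⟨_, hhalf _ (hpos x)⟩, by fun_prop⟩) ⟨?_⟩ ⟨?_⟩⟩
    · exact
        { toFun := fun q => ⟨_, hmem q.1 q.2⟩
          continuous_toFun := by fun_prop
          map_zero_left := fun x => Subtype.ext (by simp)
          map_one_left := fun x => Subtype.ext (by simp) }
    · exact
        { toFun := fun q => ⟨_, hmem' q.1 q.2⟩
          continuous_toFun := by fun_prop
          map_zero_left := fun x => Subtype.ext (by simp)
          map_one_left := fun x => Subtype.ext (by simp [c]) }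
  exact SimplyConnectedSpace.ofContractible _

/-- The vertical strips which make up the complement of all vertical lines through the points
`0, …, n - 1`: the strip to the left of `k`, and for `none` the rightmost half-plane. -/
def strip (n : ℕ) : Option (Fin n) → Set ℂ
  | none => {x | ∀ j : Fin n, (j : ℝ) < x.re}
  | some k => {x | x.re < k ∧ ∀ j : Fin n, j < k → (j : ℝ) < x.re}

theorem isOpen_strip (n : ℕ) (k : Option (Fin n)) : IsOpen (strip n k) := by
  have hj : ∀ j : Fin n, IsOpen {x : ℂ | (j : ℝ) < x.re} := fun j =>
    isOpen_lt continuous_const Complex.continuous_re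
  cases k with
  | none =>
    simp only [strip, Set.ofPred_forall]
    exact isOpen_iInter_of_finite hj
  | some k =>
    simp only [strip, Set.ofPred_and, Set.ofPred_forall]
    exact (isOpen_lt Complex.continuous_re continuous_const).inter
      (isOpen_iInter_of_finite fun j => isOpen_iInter_of_finite fun _ => hj j)

theorem isPathConnected_strip (n : ℕ) (k : Option (Fin n)) : IsPathConnected (strip n k) := by
  have hj : ∀ j : Fin n, Convex ℝ {x : ℂ | (j : ℝ) < x.re} := fun j =>
    convex_halfSpace_re_gt _
  cases k with
  | none =>
    refine Convex.isPathConnected ?_ ⟨n, fun j => ?_⟩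
    · simp only [strip, Set.ofPred_forall]
      exact convex_iInter hj
    · simp
  | some k =>
    refine Convex.isPathConnected ?_ ⟨(k : ℂ) - 1 / 2, ?_, fun j hjk => ?_⟩
    · simp only [strip, Set.ofPred_and, Set.ofPred_forall]
      exact (convex_halfSpace_re_lt _).inter (convex_iInter fun j => convex_iInter fun _ => hj j)
    · simp
    · have : ((j : ℕ) : ℝ) + 1 ≤ (k : ℕ) := by exact_mod_cast hjk
      have h2 : ((k : ℂ) - 1 / 2).re = (k : ℕ) - 1 / 2 := by simp
      rw [h2]
      linarith

theorem strip_disjoint {n : ℕ} (k l : Option (Fin n)) (x : ℂ) (hk : x ∈ strip n k)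
    (hl : x ∈ strip n l) : k = l := by
  cases k with
  | none =>
    cases l with
    | none => rfl
    | some l => exact absurd (hk l) hl.1.not_gt
  | some k =>
    cases l with
    | none => exact absurd (hl k) hk.1.not_gt
    | some l =>
      congr 1
      rcases lt_trichotomy k l with h | h | h
      · exact absurd (hl.2 k h) hk.1.not_gt
      · exact h
      · exact absurd (hk.2 l h) hl.1.not_gt

theorem exists_mem_strip_iff {n : ℕ} (x : ℂ) :
    (∃ k, x ∈ strip n k) ↔ ∀ k : Fin n, x.re ≠ k := by
  constructor
  · rintro ⟨_ | k, hk⟩ j hj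
    · exact (hk j).ne' hj
    · rcases lt_or_ge j k with h | h
      · exact (hk.2 j h).ne' hj
      · have h1 : ((k : ℕ) : ℝ) ≤ (j : ℕ) := by exact_mod_cast h
        exact absurd hk.1 (by rw [hj]; exact h1.not_gt)
  · intro h
    by_cases hx : ∃ k : Fin n, x.re < k
    · obtain ⟨k, hk, hmin⟩ := WellFounded.has_min wellFounded_lt {k : Fin n | x.re < k} hx
      exact ⟨some k, hk, fun j hj => lt_of_le_of_ne (not_lt.1 fun h' => hmin j h' hj) (h j).symm⟩
    · push Not at hx
      exact ⟨none, fun j => lt_of_le_of_ne (hx j) (h j).symm⟩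

theorem slitPlane_inter {n : ℕ} (x : ℂ) :
    (x ∈ slitPlane n (-1) ∧ x ∈ slitPlane n 1) ↔ ∃ k, x ∈ strip n k := by
  rw [exists_mem_strip_iff]
  constructor
  · rintro ⟨h1, h2⟩ k hk
    linarith [h1 k hk, h2 k hk]
  · exact fun h => ⟨fun k hk => absurd hk (h k), fun k hk => absurd hk (h k)⟩

theorem ne_stdConf_of_mem_slitPlane {n : ℕ} {s : ℝ} {x : ℂ} (hx : x ∈ slitPlane n s)
    (k : Fin n) : x ≠ (stdConf n).1 k := by
  rintro rfl
  have := hx k (by simp [stdConf])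
  simp [stdConf] at this

theorem PuncturedPlane.image_val_preimage_val {n : ℕ} {p : ConfSpace n} {A : Set ℂ}
    (hA : ∀ x ∈ A, ∀ k, x ≠ p.1 k) :
    Subtype.val '' (Subtype.val ⁻¹' A : Set (PuncturedPlane p)) = A := by
  ext x
  exact ⟨fun ⟨y, hy, e⟩ => e ▸ hy, fun hx => ⟨⟨x, hA x hx⟩, hx, rfl⟩⟩

/-- The cover of the plane punctured at `0, …, n - 1` by the two slit planes. -/
noncomputable def stdCover (n : ℕ) : TwoSetCover (Fin n) (PuncturedPlane (stdConf n)) where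
  U i := Subtype.val ⁻¹' slitPlane n (cond i 1 (-1))
  isOpen_U i := (isOpen_slitPlane n _).preimage continuous_subtype_val
  cover x := by
    rcases lt_trichotomy x.1.im 0 with h | h | h
    · exact ⟨false, fun _ _ => by simpa using h⟩
    · refine ⟨false, fun k hk => absurd ?_ (x.2 k)⟩
      exact Complex.ext (by simpa [stdConf] using hk) (by simpa [stdConf] using h)
    · exact ⟨true, fun _ _ => by simpa using h⟩
  simplyConnected i := by
    rw [← Topology.IsEmbedding.subtypeVal.isSimplyConnected_image,
      PuncturedPlane.image_val_preimage_val fun x hx => ne_stdConf_of_mem_slitPlane hx]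
    exact isSimplyConnected_slitPlane n (by cases i <;> simp)
  S k := Subtype.val ⁻¹' strip n k
  isOpen_S k := (isOpen_strip n k).preimage continuous_subtype_val
  pathConnected k := by
    have hval : Topology.IsInducing (Subtype.val : PuncturedPlane (stdConf n) → ℂ) := .subtypeVal
    rw [hval.isPathConnected_iff, PuncturedPlane.image_val_preimage_val fun x hx =>
      ne_stdConf_of_mem_slitPlane ((slitPlane_inter x).2 ⟨k, hx⟩).1]
    exact isPathConnected_strip n k
  disjoint k l x := strip_disjoint k l x.1
  inter x := by
    rw [Bool.forall_bool]
    exact slitPlane_inter x.1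

theorem sectionPoint_stdConf_mem (n : ℕ) : sectionPoint (stdConf n) ∈ (stdCover n).S none := by
  intro j
  have h : ‖(stdConf n).1 j‖ ≤ ∑ k, ‖(stdConf n).1 k‖ :=
    Finset.single_le_sum (f := fun k => ‖(stdConf n).1 k‖) (fun _ _ => norm_nonneg _)
      (Finset.mem_univ j)
  have h1 : ‖(stdConf n).1 j‖ = j := by simp [stdConf]
  rw [h1] at h
  simp only [sectionPoint, Complex.ofReal_re]
  linarith

end StandardConfiguration

/-! ### Split extensions, base points and pure braid groups -/

section SplitExtension

variable {N G H : Type*} [Group N] [Group G] [Group H]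

/-- A surjection `f` with a section `s` exhibits its source as a semidirect product of its kernel
with its target. -/
theorem exists_semidirectProduct_of_section (f : G →* H) (s : H →* G) (hs : ∀ h, f (s h) = h)
    (κ : N ≃* f.ker) :
    ∃ (φ : H →* MulAut N) (e : G ≃* N ⋊[φ] H),
      (∀ g, SemidirectProduct.rightHom (e g) = f g) ∧ ∀ h, e (s h) = SemidirectProduct.inr h := by
  let φ : H →* MulAut N :=
    (MulAut.congr κ.symm).toMonoidHom.comp ((MulAut.conjNormal (H := f.ker)).comp s)
  have hφ : ∀ h x, (κ (φ h x) : G) = s h * κ x * (s h)⁻¹ := fun h x => by simp [φ]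
  let Φ : N ⋊[φ] H →* G := SemidirectProduct.lift (f.ker.subtype.comp κ.toMonoidHom) s
    fun h => MonoidHom.ext fun x => hφ h x
  have hΦ : ∀ x, Φ x = κ x.left * s x.right := fun x => rfl
  have hfΦ : ∀ x, f (Φ x) = x.right := fun x => by
    rw [hΦ, map_mul, hs, (κ x.left).2, one_mul]
  have hbij : Function.Bijective Φ := by
    refine ⟨(injective_iff_map_eq_one _).2 fun x hx => ?_, fun g => ?_⟩
    · have hr : x.right = 1 := by rw [← hfΦ, hx, map_one]
      have hl : (κ x.left : G) = 1 := by rwa [hΦ, hr, map_one, mul_one] at hx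
      exact SemidirectProduct.ext (by simpa using hl) hr
    · have hg : g * (s (f g))⁻¹ ∈ f.ker := by simp [MonoidHom.mem_ker, hs]
      exact ⟨⟨κ.symm ⟨_, hg⟩, f g⟩, by simp [hΦ]⟩
  refine ⟨φ, (MulEquiv.ofBijective Φ hbij).symm, fun g => ?_, fun h => ?_⟩
  · obtain ⟨x, rfl⟩ := hbij.2 g
    rw [hfΦ, ← MulEquiv.ofBijective_apply Φ hbij, MulEquiv.symm_apply_apply]
    rfl
  · rw [MulEquiv.symm_apply_eq]
    exact (by simp [hΦ] : Φ (SemidirectProduct.inr h) = s h).symm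

theorem SemidirectProduct.inl_bijective [Subsingleton H] (φ : H →* MulAut N) :
    Function.Bijective (SemidirectProduct.inl : N →* N ⋊[φ] H) :=
  ⟨SemidirectProduct.inl_injective, fun x =>
    ⟨x.left, SemidirectProduct.ext rfl (Subsingleton.elim _ _)⟩⟩

end SplitExtension

section BasePoint

open FundamentalGroup

variable {X Y : Type*} [TopologicalSpace X] [TopologicalSpace Y]

/-- Change of base point is natural. -/
theorem FundamentalGroup.map_mulEquivOfPath (f : C(X, Y)) {q q' : X} (γ : Path q q')
    (g : FundamentalGroup X q) :
    map f q' (fundamentalGroupMulEquivOfPath γ g) =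
      fundamentalGroupMulEquivOfPath (γ.map f.continuous) (map f q g) := by
  obtain ⟨α, rfl⟩ := Path.Homotopic.Quotient.mk_surjective g
  change Path.Homotopic.Quotient.mk ((γ.symm.trans (α.trans γ)).map f.continuous) =
    Path.Homotopic.Quotient.mk ((γ.map f.continuous).symm.trans
      ((α.map f.continuous).trans (γ.map f.continuous)))
  rw [Path.map_trans, Path.map_trans, Path.map_symm]

/-- The kernels of the maps induced on the fundamental groups at two base points which are joined
by a path are isomorphic. -/
theorem FundamentalGroup.nonempty_ker_mulEquiv (f : C(X, Y)) {q q' : X} (γ : Path q q') :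
    Nonempty ((map f q).ker ≃* (map f q').ker) := by
  refine ⟨((fundamentalGroupMulEquivOfPath γ).subgroupMap (map f q).ker).trans
    (MulEquiv.subgroupCongr ?_)⟩
  ext g
  constructor
  · rintro ⟨a, ha, rfl⟩
    refine (map_mulEquivOfPath f γ a).trans ?_
    rw [MonoidHom.mem_ker.1 ha, map_one]
  · refine fun hg => ⟨(fundamentalGroupMulEquivOfPath γ).symm g, ?_,
      (fundamentalGroupMulEquivOfPath γ).apply_symm_apply g⟩
    apply (fundamentalGroupMulEquivOfPath (γ.map f.continuous)).injective
    rw [← map_mulEquivOfPath, MulEquiv.apply_symm_apply, map_one]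
    exact hg

/-- A section of the homomorphism induced by `f` can be transported along a path. -/
theorem FundamentalGroup.exists_section (f : C(X, Y)) {q q' : X} (γ : Path q q')
    (h : ∃ s : FundamentalGroup Y (f q') →* FundamentalGroup X q', ∀ δ, map f q' (s δ) = δ) :
    ∃ s : FundamentalGroup Y (f q) →* FundamentalGroup X q, ∀ δ, map f q (s δ) = δ := by
  obtain ⟨s, hs⟩ := h
  refine ⟨(fundamentalGroupMulEquivOfPath γ).symm.toMonoidHom.comp
    (s.comp (fundamentalGroupMulEquivOfPath (γ.map f.continuous)).toMonoidHom), fun δ => ?_⟩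
  apply (fundamentalGroupMulEquivOfPath (γ.map f.continuous)).injective
  rw [← map_mulEquivOfPath]
  simp [hs]

end BasePoint

section PureBraid

variable {n : ℕ}

instance (p : ConfSpace n) : PathConnectedSpace (PuncturedPlane p) := by
  have h := (Set.finite_range p.1).countable.isPathConnected_compl_of_one_lt_rank
    (by rw [Complex.rank_real_complex]; exact Cardinal.one_lt_two)
  have : (Set.range p.1)ᶜ = {x | ∀ i, x ≠ p.1 i} := by
    ext x
    simp [eq_comm]
  rw [this] at h
  exact isPathConnected_iff_pathConnectedSpace.1 h

theorem fiberInclusion_last (q : ConfSpace (n + 1)) :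
    fiberInclusion (forgetLast n q) ⟨q.last, q.last_ne⟩ = q :=
  ConfSpace.ext_last (by simp) (by simp)

theorem ConfSpace.joined_addPoint (q : ConfSpace (n + 1)) :
    Joined q (addPoint n (forgetLast n q)) := by
  have h := (PathConnectedSpace.joined
    (⟨q.last, q.last_ne⟩ : PuncturedPlane (forgetLast n q)) (sectionPoint _)).map
      (fiberInclusion (forgetLast n q)).continuous
  rwa [fiberInclusion_last] at h

/-- Configuration spaces are path connected: a point is joined to the cross-section inside its
fibre. -/
theorem ConfSpace.pathConnectedSpace : ∀ n, PathConnectedSpace (ConfSpace n)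
  | 0 =>
    { nonempty := ⟨⟨Fin.elim0, fun i => i.elim0⟩⟩
      joined := fun p q => by
        rw [Subsingleton.elim p q] }
  | n + 1 =>
    { nonempty := ⟨addPoint n (ConfSpace.pathConnectedSpace n).nonempty.some⟩
      joined := fun p q => p.joined_addPoint.trans
        ((((ConfSpace.pathConnectedSpace n).joined _ _).map (addPoint n).continuous).trans
          q.joined_addPoint.symm) }

theorem map_forgetLast_mapOfEq_addPoint (q : ConfSpace (n + 1))
    (h : addPoint n (forgetLast n q) = q) (δ : PureBraidGroup n (forgetLast n q)) :
    FundamentalGroup.map (forgetLast n) q (FundamentalGroup.mapOfEq (addPoint n) h δ) = δ := by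
  rw [FundamentalGroup.mapOfEq_apply]
  obtain ⟨α, rfl⟩ := Path.Homotopic.Quotient.mk_surjective δ
  exact congrArg Path.Homotopic.Quotient.mk (Path.ext (funext fun t => forgetLast_addPoint (α t)))

/-- The homomorphism induced by `forgetLast n` has a section at every base point. -/
theorem exists_section_map_forgetLast (q : ConfSpace (n + 1)) :
    ∃ s : PureBraidGroup n (forgetLast n q) →* PureBraidGroup (n + 1) q,
      (∀ δ, FundamentalGroup.map (forgetLast n) q (s δ) = δ) ∧
      ∀ (h : addPoint n (forgetLast n q) = q) δ,
        FundamentalGroup.mapOfEq (addPoint n) h δ = s δ := by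
  by_cases h : addPoint n (forgetLast n q) = q
  · exact ⟨FundamentalGroup.mapOfEq (addPoint n) h, map_forgetLast_mapOfEq_addPoint q h,
      fun _ _ => rfl⟩
  · have h' : addPoint n (forgetLast n (addPoint n (forgetLast n q))) =
        addPoint n (forgetLast n q) := by rw [forgetLast_addPoint]
    obtain ⟨s, hs⟩ := FundamentalGroup.exists_section (forgetLast n) q.joined_addPoint.somePath
      ⟨_, map_forgetLast_mapOfEq_addPoint _ h'⟩
    exact ⟨s, hs, fun h'' => absurd h'' h⟩

/-- The kernel of the homomorphism induced by `forgetLast n` is free of rank `n`. -/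
theorem nonempty_freeGroup_mulEquiv_ker (q : ConfSpace (n + 1)) :
    Nonempty (FreeGroup (Fin n) ≃* (FundamentalGroup.map (forgetLast n) q).ker) := by
  let p := stdConf n
  let ι := FundamentalGroup.map (fiberInclusion p) (sectionPoint p)
  have hker : ι.range = (FundamentalGroup.map (forgetLast n)
      (fiberInclusion p (sectionPoint p))).ker := by
    ext g
    refine ⟨?_, fun hg => exists_map_fiberInclusion_eq hg⟩
    rintro ⟨a, rfl⟩
    exact map_forgetLast_map_fiberInclusion a
  have := ConfSpace.pathConnectedSpace (n + 1)
  obtain ⟨e⟩ := FundamentalGroup.nonempty_ker_mulEquiv (forgetLast n)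
    (PathConnectedSpace.somePath (fiberInclusion p (sectionPoint p)) q)
  exact ⟨(((stdCover n).freeGroupEquiv (sectionPoint_stdConf_mem n)).trans
    (MonoidHom.ofInjective (map_fiberInclusion_injective p))).trans
      ((MulEquiv.subgroupCongr hker).trans e)⟩

/-- The semidirect product decomposition, compatible with the projection and with the
cross-section where the latter preserves the base point. -/
theorem exists_pureBraidGroup_mulEquiv (q : ConfSpace (n + 1)) :
    ∃ (φ : PureBraidGroup n (forgetLast n q) →* MulAut (FreeGroup (Fin n)))
      (e : PureBraidGroup (n + 1) q ≃*
        FreeGroup (Fin n) ⋊[φ] PureBraidGroup n (forgetLast n q)),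
      (∀ γ, SemidirectProduct.rightHom (e γ) = FundamentalGroup.map (forgetLast n) q γ) ∧
      ∀ (h : addPoint n (forgetLast n q) = q) δ,
        e (FundamentalGroup.mapOfEq (addPoint n) h δ) = SemidirectProduct.inr δ := by
  obtain ⟨s, hs, hs'⟩ := exists_section_map_forgetLast q
  obtain ⟨κ⟩ := nonempty_freeGroup_mulEquiv_ker q
  obtain ⟨φ, e, h1, h2⟩ := exists_semidirectProduct_of_section _ s hs κ
  exact ⟨φ, e, h1, fun h δ => by rw [hs' h, h2]⟩

/-- `C_1(ℂ)` is homeomorphic to the contractible space `ℂ¹`. -/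
instance : ContractibleSpace (ConfSpace 1) :=
  let e : ConfSpace 1 ≃ₜ (Fin 1 → ℂ) :=
    { toEquiv := Equiv.subtypeUnivEquiv fun _ _ _ hij => absurd (Subsingleton.elim _ _) hij
      continuous_toFun := continuous_subtype_val
      continuous_invFun := continuous_id.subtype_mk _ }
  e.contractibleSpace

/-- Induction on `n`; the group `PB_1` at the start is trivial. -/
theorem exists_isIteratedSemidirectFree (hn : 1 ≤ n) (q : ConfSpace (n + 1)) :
    ∃ (G : Type) (_ : Group G),
      IsIteratedSemidirectFree n G ∧ Nonempty (PureBraidGroup (n + 1) q ≃* G) := by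
  induction n, hn using Nat.le_induction with
  | base =>
    obtain ⟨φ, e, -⟩ := exists_pureBraidGroup_mulEquiv q
    exact ⟨_, _, .base,
      ⟨e.trans (MulEquiv.ofBijective _ (SemidirectProduct.inl_bijective φ)).symm⟩⟩
  | succ n _ ih =>
    obtain ⟨φ, e, -⟩ := exists_pureBraidGroup_mulEquiv q
    obtain ⟨G, _, hG, ⟨e'⟩⟩ := ih (forgetLast (n + 1) q)
    exact ⟨_, _, .step n G _ hG, ⟨e.trans (SemidirectProduct.congr' (MulEquiv.refl _) e')⟩⟩

end PureBraid

theorem mainTheorem5 (n : ℕ) (hn : 1 ≤ n) :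
    -- `PB_{n+1} ≅ F_n ⋊ PB_n`, for all choices of the two base points
    (∀ (p : ConfSpace n) (q : ConfSpace (n + 1)),
      ∃ φ : PureBraidGroup n p →* MulAut (FreeGroup (Fin n)),
        Nonempty (PureBraidGroup (n + 1) q ≃* FreeGroup (Fin n) ⋊[φ] PureBraidGroup n p)) ∧
    -- for compatible base points, the projection onto `PB_n` is induced by the forgetful map, and
    -- the inclusion of `PB_n` by the cross-section when the latter preserves the base points
    (∀ q : ConfSpace (n + 1),
      ∃ (φ : PureBraidGroup n (forgetLast n q) →* MulAut (FreeGroup (Fin n)))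
        (e : PureBraidGroup (n + 1) q ≃*
          FreeGroup (Fin n) ⋊[φ] PureBraidGroup n (forgetLast n q)),
        (∀ γ : PureBraidGroup (n + 1) q,
          SemidirectProduct.rightHom (e γ) = FundamentalGroup.map (forgetLast n) q γ) ∧
        (∀ (h : addPoint n (forgetLast n q) = q) (δ : PureBraidGroup n (forgetLast n q)),
          e (FundamentalGroup.mapOfEq (addPoint n) h δ) = SemidirectProduct.inr δ)) ∧
    -- `PB_{n+1} ≅ F_n ⋊ (F_{n-1} ⋊ (⋯ ⋊ (F_2 ⋊ F_1)))`
    (∀ q : ConfSpace (n + 1), ∃ (G : Type) (_ : Group G),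
      IsIteratedSemidirectFree n G ∧ Nonempty (PureBraidGroup (n + 1) q ≃* G)) := by
  refine ⟨fun p q => ?_, exists_pureBraidGroup_mulEquiv, exists_isIteratedSemidirectFree hn⟩
  have := ConfSpace.pathConnectedSpace n
  obtain ⟨φ, e, -⟩ := exists_pureBraidGroup_mulEquiv q
  exact ⟨_, ⟨e.trans (SemidirectProduct.congr' (MulEquiv.refl _)
    (FundamentalGroup.fundamentalGroupMulEquivOfPathConnected (forgetLast n q) p))⟩⟩
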